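/- Let $n\ge 1$, let $\Omega\subset\mathbb{R}^n$ be a bounded domain, let $p>2$, and let $f\in C^1(\Omega)$ satisfy $0<\inf_\Omega f\le\sup_\Omega f<\infty$ and $\sup_\Omega|Df|<\infty$. Put $$\alpha=\frac{p-2}{p+n},\qquad \beta=1-\alpha,\qquad \gamma(x)=\frac{f(x)}{\frac{|Df(x)|}{2(p+n)}+f(x)}\quad(x\in\Omega).$$ Let $\epsilon>0$, let $B_\epsilon(x)$ be the open ball, and let $\Gamma_\epsilon=\{y\in\mathbb{R}^n\setminus\Omega : \operatorname{dist}(y,\Omega)\le\epsilon\}$ and $\Omega_\epsilon=\Omega\cup\Gamma_\epsilon$. Assume that $x+\epsilon^2\frac{Df(x)}{|Df(x)|}\in\Omega_\epsilon$ for every $x\in\Omega$ with $Df(x)\ne0$ (this is automatic if $\epsilon\le1$). Let $F:\Gamma_\epsilon\to\mathbb{R}$ be bounded and Borel measurable. The game. A token starts at $x_0\in\Omega_\epsilon$. A strategy $S$ assigns, Borel measurably for each $k$, to every history $(x_0,\dots,x_k)$ a point $S(x_0,\dots,x_k)\in B_\epsilon(x_k)$. Given strategies $S_A,S_B$ of the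 two players and $x_k\in\Omega$, the next position $x_{k+1}$ is: $S_A(x_0,\dots,x_k)$ with probability $\gamma(x_k)\frac{\alpha}{2}$; $S_B(x_0,\dots,x_k)$ with probability $\gamma(x_k)\frac{\alpha}{2}$; uniformly distributed in $B_\epsilon(x_k)$ with probability $\gamma(x_k)\beta$; and, if $Df(x_k)\neq0$, equal to $x_k+\epsilon^2\frac{Df(x_k)}{|Df(x_k)|}$ with probability $1-\gamma(x_k)$. The game stops at the first time $\tau$ at which $x_\tau\in\Gamma_\epsilon$. Let $\mathbb{E}^{x_0}_{S_A,S_B}$ be the expectation for the resulting law of $(x_0,x_1,\dots)$. The values of Players A and B are $$u_A^\epsilon(x_0)=\sup_{S_A}\inf_{S_B}\mathbb{E}^{x_0}_{S_A,S_B}[F(x_\tau)],\qquad u_B^\epsilon(x_0)=\inf_{S_B}\sup_{S_A}\mathbb{E}^{x_0}_{S_A,S_B}[F(x_\tau)].$$ Lemma. Let $v:\Omega_\epsilon\to\mathbb{R}$ be any Borel measurable function with $v=F$ on $\Gamma_\epsilon$ that satisfies the dynamic programming principle in $\Omega$: for every $x\in\Omega$, the quantities $\sup_{B_\epsilon(x)}v$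 and $\inf_{B_\epsilon(x)}v$ are finite and $$v(x)=\gamma(x)\frac{\alpha}{2}\Bigl(\sup_{B_\epsilon(x)}v+\inf_{B_\epsilon(x)}v\Bigr)+\gamma(x)\,\beta\,\frac{1}{|B_\epsilon(0)|}\int_{B_\epsilon(0)}v(x+h)\,dh+U(v)(x),$$ where $U(v)(x)=(1-\gamma(x))\,v\bigl(x+\epsilon^2\frac{Df(x)}{|Df(x)|}\bigr)$ if $Df(x)\neq0$ and $U(v)(x)=0$ if $Df(x)=0$. Then, for every $x_0\in\Omega_\epsilon$ and all strategies $S_A,S_B$, almost surely the token reaches $\Gamma_\epsilon$ in finite time, $F(x_\tau)$ is integrable, and $$u_A^\epsilon(x_0)=u_B^\epsilon(x_0)=v(x_0).$$ In particular the game has a value. -/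

import Mathlib

open MeasureTheory ProbabilityTheory

noncomputable section

/-- The data and standing assumptions of the game: a bounded domain `Ω ⊆ ℝⁿ`, a weight
`f ∈ C¹(Ω)` with `0 < inf f ≤ sup f < ∞`, an exponent `p > 2` and a step size `ε > 0`.
(`f` is a total function, but only its values in the open set `Ω` are ever used.) -/
structure TugOfWar (n : ℕ) where
  Ω : Set (EuclideanSpace ℝ (Fin n))
  f : EuclideanSpace ℝ (Fin n) → ℝ
  p : ℝ
  ε : ℝ
  one_le_n : 1 ≤ n
  isOpen_Ω : IsOpen Ω
  isConnected_Ω : IsConnected Ω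
  isBounded_Ω : Bornology.IsBounded Ω
  contDiffOn_f : ContDiffOn ℝ 1 f Ω
  f_lower : ∃ c > 0, ∀ x ∈ Ω, c ≤ f x
  f_upper : ∃ C, ∀ x ∈ Ω, f x ≤ C
  two_lt_p : 2 < p
  ε_pos : 0 < ε

namespace TugOfWar

variable {n : ℕ} (G : TugOfWar n)

/-- `α = (p - 2) / (p + n)`. -/
def α : ℝ := (G.p - 2) / (G.p + n)

/-- `β = 1 - α`. -/
def β : ℝ := 1 - G.α

/-- `γ(x) = f(x) / (|Df(x)| / (2 (p + n)) + f(x))`. -/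
def γ (x : EuclideanSpace ℝ (Fin n)) : ℝ :=
  G.f x / (‖gradient G.f x‖ / (2 * (G.p + n)) + G.f x)

/-- The exterior neighbourhood `Γ_ε = {y ∉ Ω | dist(y, Ω) ≤ ε}`. -/
def Γ : Set (EuclideanSpace ℝ (Fin n)) := {y | y ∉ G.Ω ∧ Metric.infDist y G.Ω ≤ G.ε}

/-- The set `Ω_ε = Ω ∪ Γ_ε` of positions of the token. -/
def board : Set (EuclideanSpace ℝ (Fin n)) := G.Ω ∪ G.Γ

/-- `x + ε² Df(x) / |Df(x)|`. -/
def driftTarget (x : EuclideanSpace ℝ (Fin n)) : EuclideanSpace ℝ (Fin n) :=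
  x + (G.ε ^ 2 / ‖gradient G.f x‖) • gradient G.f x

open Classical in
/-- The term `U(w)` of the dynamic programming principle. -/
def U (w : EuclideanSpace ℝ (Fin n) → ℝ) (x : EuclideanSpace ℝ (Fin n)) : ℝ :=
  if gradient G.f x ≠ 0 then (1 - G.γ x) * w (G.driftTarget x) else 0

/-- The dynamic programming principle for `w` in `Ω`. The two boundedness clauses say that the
supremum and the infimum in the equation are finite. -/
def SatisfiesDPP (w : EuclideanSpace ℝ (Fin n) → ℝ) : Prop :=
  ∀ x ∈ G.Ω,
    BddAbove (w '' Metric.ball x G.ε) ∧ BddBelow (w '' Metric.ball x G.ε) ∧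
    w x = G.γ x * (G.α / 2) * (sSup (w '' Metric.ball x G.ε) + sInf (w '' Metric.ball x G.ε))
      + G.γ x * G.β * (⨍ h in Metric.ball (0 : EuclideanSpace ℝ (Fin n)) G.ε, w (x + h))
      + G.U w x

/-- Histories `(x₀, …, x_k)` of a token that has moved `k` times. -/
abbrev History (n k : ℕ) : Type := Finset.Iic k → EuclideanSpace ℝ (Fin n)

/-- The current position `x_k` of the history `(x₀, …, x_k)`. -/
def History.last {n k : ℕ} (h : History n k) : EuclideanSpace ℝ (Fin n) :=
  h ⟨k, Finset.mem_Iic.mpr le_rfl⟩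

/-- A strategy: a (Borel) function on histories with `S(x₀, …, x_k) ∈ B_ε(x_k)`. -/
structure Strategy where
  move : ∀ k : ℕ, History n k → EuclideanSpace ℝ (Fin n)
  measurable_move : ∀ k, Measurable (move k)
  move_mem : ∀ k (h : History n k), move k h ∈ Metric.ball h.last G.ε

variable {G}

open Classical in
/-- The transition probability `π_{S_A,S_B}(x₀, …, x_k, ·)`. The game is over once the token has
left `Ω`; the token then stays where it is. -/
def stepLaw (SA SB : G.Strategy) (k : ℕ) (h : History n k) :
    Measure (EuclideanSpace ℝ (Fin n)) :=
  if h.last ∈ G.Ω then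
    ENNReal.ofReal (G.γ h.last * G.β) •
        ((volume (Metric.ball h.last G.ε))⁻¹ • volume.restrict (Metric.ball h.last G.ε))
      + ENNReal.ofReal (G.γ h.last * (G.α / 2)) • Measure.dirac (SA.move k h)
      + ENNReal.ofReal (G.γ h.last * (G.α / 2)) • Measure.dirac (SB.move k h)
      + (if gradient G.f h.last ≠ 0 then
          ENNReal.ofReal (1 - G.γ h.last) • Measure.dirac (G.driftTarget h.last)
        else 0)
  else Measure.dirac h.last

lemma α_pos : 0 < G.α := by
  have h2 := G.two_lt_p
  have hn : (0 : ℝ) ≤ n := Nat.cast_nonneg n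
  exact div_pos (by linarith) (by linarith)

lemma β_pos : 0 < G.β := by
  have h2 := G.two_lt_p
  have hn : (0 : ℝ) ≤ n := Nat.cast_nonneg n
  have : G.α < 1 := by
    unfold α
    rw [div_lt_one (by linarith)]
    linarith
  unfold β
  linarith

lemma γ_mem {x : EuclideanSpace ℝ (Fin n)} (hx : x ∈ G.Ω) : 0 < G.γ x ∧ G.γ x ≤ 1 := by
  obtain ⟨c, hc, hf⟩ := G.f_lower
  have hfx : 0 < G.f x := lt_of_lt_of_le hc (hf x hx)
  have h2 := G.two_lt_p
  have hn : (0 : ℝ) ≤ n := Nat.cast_nonneg n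
  have hq : 0 ≤ ‖gradient G.f x‖ / (2 * (G.p + n)) :=
    div_nonneg (norm_nonneg _) (by linarith)
  refine ⟨div_pos hfx (by linarith), ?_⟩
  unfold γ
  rw [div_le_one (by linarith)]
  linarith

lemma γ_eq_one {x : EuclideanSpace ℝ (Fin n)} (hx : x ∈ G.Ω) (h0 : gradient G.f x = 0) :
    G.γ x = 1 := by
  obtain ⟨c, hc, hf⟩ := G.f_lower
  have hfx : G.f x ≠ 0 := (lt_of_lt_of_le hc (hf x hx)).ne'
  simp [γ, h0, hfx]

instance isProbabilityMeasure_stepLaw (SA SB : G.Strategy) (k : ℕ) (h : History n k) :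
    IsProbabilityMeasure (stepLaw SA SB k h) := by
  constructor
  unfold stepLaw
  split_ifs with hx h0
  · obtain ⟨g0, g1⟩ := γ_mem hx
    have ha := G.α_pos
    have hb := G.β_pos
    have hball : volume (Metric.ball h.last G.ε) ≠ 0 :=
      (Metric.measure_ball_pos volume h.last G.ε_pos).ne'
    have hball' : volume (Metric.ball h.last G.ε) ≠ ⊤ := measure_ball_lt_top.ne
    have e1 : (0 : ℝ) ≤ G.γ h.last * G.β := by positivity
    have e2 : (0 : ℝ) ≤ G.γ h.last * (G.α / 2) := by positivity
    simp only [Measure.add_apply, Measure.smul_apply, Measure.restrict_apply_univ, smul_eq_mul,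
      measure_univ, mul_one, ENNReal.inv_mul_cancel hball hball']
    rw [← ENNReal.ofReal_add e1 e2, ← ENNReal.ofReal_add (by positivity) e2,
      ← ENNReal.ofReal_add (by positivity) (by linarith), ← ENNReal.ofReal_one]
    congr 1
    unfold β
    ring
  · obtain ⟨g0, g1⟩ := γ_mem hx
    have ha := G.α_pos
    have hb := G.β_pos
    have hball : volume (Metric.ball h.last G.ε) ≠ 0 :=
      (Metric.measure_ball_pos volume h.last G.ε_pos).ne'
    have hball' : volume (Metric.ball h.last G.ε) ≠ ⊤ := measure_ball_lt_top.ne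
    have e1 : (0 : ℝ) ≤ G.γ h.last * G.β := by positivity
    have e2 : (0 : ℝ) ≤ G.γ h.last * (G.α / 2) := by positivity
    have hg : G.γ h.last = 1 := γ_eq_one hx (not_not.mp h0)
    simp only [Measure.add_apply, Measure.smul_apply, Measure.restrict_apply_univ, smul_eq_mul,
      measure_univ, mul_one, ENNReal.inv_mul_cancel hball hball',
      add_zero]
    rw [← ENNReal.ofReal_add e1 e2, ← ENNReal.ofReal_add (by positivity) e2,
      ← ENNReal.ofReal_one, hg]
    congr 1
    unfold β
    ring
  · simp

lemma measurable_gradient : Measurable (gradient G.f) := by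
  unfold gradient
  exact (InnerProductSpace.toDual ℝ (EuclideanSpace ℝ (Fin n))).symm.continuous.measurable.comp
    (measurable_fderiv ℝ G.f)

lemma measurable_indicator_γ : Measurable (G.Ω.indicator G.γ) := by
  have hf : Measurable (G.Ω.indicator G.f) := by
    classical
    rw [← Set.piecewise_eq_indicator]
    exact ContinuousOn.measurable_piecewise G.contDiffOn_f.continuousOn
      continuousOn_const G.isOpen_Ω.measurableSet
  have h2 : Measurable fun x => G.Ω.indicator G.f x /
      (‖gradient G.f x‖ / (2 * (G.p + n)) + G.Ω.indicator G.f x) :=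
    hf.div (((measurable_gradient (G := G)).norm.div_const _).add hf)
  have h3 : G.Ω.indicator G.γ = fun x => G.Ω.indicator G.f x /
      (‖gradient G.f x‖ / (2 * (G.p + n)) + G.Ω.indicator G.f x) := by
    ext x
    by_cases hx : x ∈ G.Ω <;> simp [hx, γ]
  rw [h3]
  exact h2

lemma measurable_driftTarget : Measurable G.driftTarget := by
  have hg := measurable_gradient (G := G)
  unfold driftTarget
  exact measurable_id.add ((measurable_const.div hg.norm).smul hg)

lemma measurable_last {k : ℕ} : Measurable (History.last : History n k → _) :=
  measurable_pi_apply _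

lemma measurable_uniform :
    Measurable fun x : EuclideanSpace ℝ (Fin n) =>
      ((volume (Metric.ball x G.ε))⁻¹ • volume.restrict (Metric.ball x G.ε) :
        Measure (EuclideanSpace ℝ (Fin n))) := by
  have key : ∀ A : Set (EuclideanSpace ℝ (Fin n)), MeasurableSet A →
      Measurable fun x => volume (A ∩ Metric.ball x G.ε) := by
    intro A hA
    have hS : MeasurableSet {q : EuclideanSpace ℝ (Fin n) × EuclideanSpace ℝ (Fin n) |
        q.2 ∈ A ∧ dist q.2 q.1 < G.ε} :=
      (measurable_snd hA).inter (measurableSet_lt (measurable_snd.dist measurable_fst)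
        measurable_const)
    exact measurable_measure_prodMk_left hS
  refine Measure.measurable_of_measurable_coe _ fun A hA => ?_
  simp only [Measure.smul_apply, Measure.restrict_apply hA, smul_eq_mul]
  refine Measurable.mul (Measurable.inv ?_) (key A hA)
  simpa using key Set.univ MeasurableSet.univ

lemma measurable_stepLaw (SA SB : G.Strategy) (k : ℕ) : Measurable (stepLaw SA SB k) := by
  classical
  have hl := measurable_last (n := n) (k := k)
  have hγ : Measurable fun h : History n k => G.Ω.indicator G.γ h.last :=
    measurable_indicator_γ.comp hl
  have heq : stepLaw SA SB k = fun h : History n k =>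
      if h.last ∈ G.Ω then
        ENNReal.ofReal (G.Ω.indicator G.γ h.last * G.β) •
          ((volume (Metric.ball h.last G.ε))⁻¹ • volume.restrict (Metric.ball h.last G.ε))
        + ENNReal.ofReal (G.Ω.indicator G.γ h.last * (G.α / 2)) • Measure.dirac (SA.move k h)
        + ENNReal.ofReal (G.Ω.indicator G.γ h.last * (G.α / 2)) • Measure.dirac (SB.move k h)
        + (if gradient G.f h.last ≠ 0 then
            ENNReal.ofReal (1 - G.Ω.indicator G.γ h.last) • Measure.dirac (G.driftTarget h.last)
          else 0)
      else Measure.dirac h.last := by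
    ext1 h
    by_cases hx : h.last ∈ G.Ω <;> simp [stepLaw, hx]
  have smul_meas : ∀ (c : History n k → ENNReal)
      (m : History n k → Measure (EuclideanSpace ℝ (Fin n))),
      Measurable c → Measurable m → Measurable fun h => c h • m h := by
    intro c m hc hm
    refine Measure.measurable_of_measurable_coe _ fun A hA => ?_
    simp only [Measure.smul_apply, smul_eq_mul]
    exact hc.mul ((Measure.measurable_coe hA).comp hm)
  have add_meas : ∀ m m' : History n k → Measure (EuclideanSpace ℝ (Fin n)),
      Measurable m → Measurable m' → Measurable fun h => m h + m' h := by
    intro m m' hm hm'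
    refine Measure.measurable_of_measurable_coe _ fun A hA => ?_
    simp only [Measure.add_apply]
    exact ((Measure.measurable_coe hA).comp hm).add ((Measure.measurable_coe hA).comp hm')
  rw [heq]
  refine Measurable.ite (hl G.isOpen_Ω.measurableSet) ?_ (Measure.measurable_dirac.comp hl)
  refine add_meas _ _ (add_meas _ _ (add_meas _ _ ?_ ?_) ?_) ?_
  · exact smul_meas _ _ (hγ.mul_const _).ennreal_ofReal (measurable_uniform.comp hl)
  · exact smul_meas _ _ (hγ.mul_const _).ennreal_ofReal
      (Measure.measurable_dirac.comp (SA.measurable_move k))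
  · exact smul_meas _ _ (hγ.mul_const _).ennreal_ofReal
      (Measure.measurable_dirac.comp (SB.measurable_move k))
  · refine Measurable.ite ?_ (smul_meas _ _ (measurable_const.sub hγ).ennreal_ofReal
      (Measure.measurable_dirac.comp (measurable_driftTarget.comp hl))) measurable_const
    exact ((measurable_gradient (G := G)).comp hl) (measurableSet_singleton 0).compl

/-- The transition probabilities as a Markov kernel from histories of length `k` to positions. -/
def stepKernel (SA SB : G.Strategy) (k : ℕ) :
    Kernel (History n k) (EuclideanSpace ℝ (Fin n)) where
  toFun := stepLaw SA SB k
  measurable' := measurable_stepLaw SA SB k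

instance isMarkovKernel_stepKernel (SA SB : G.Strategy) (k : ℕ) :
    IsMarkovKernel (stepKernel SA SB k) :=
  ⟨fun h => isProbabilityMeasure_stepLaw SA SB k h⟩

/-- The law of the infinite sequence of positions `(x₀, x₁, …)` of the game started at `x₀`:
the measure with initial distribution `δ_{x₀}` and transition probabilities `stepLaw`. -/
def law (SA SB : G.Strategy) (x₀ : EuclideanSpace ℝ (Fin n)) :
    Measure (ℕ → EuclideanSpace ℝ (Fin n)) :=
  Kernel.traj (X := fun _ => EuclideanSpace ℝ (Fin n)) (fun k => stepKernel SA SB k) 0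
    (fun _ => x₀)

variable (G)

/-- The exit time `τ = inf {k | x_k ∈ Γ_ε}`. -/
def exitTime (ω : ℕ → EuclideanSpace ℝ (Fin n)) : ℕ := sInf {k | ω k ∈ G.Γ}

/-- The payoff `F(x_τ)`. -/
def payoff (F : EuclideanSpace ℝ (Fin n) → ℝ) (ω : ℕ → EuclideanSpace ℝ (Fin n)) : ℝ :=
  F (ω (G.exitTime ω))

/-- The value of Player A, `sup_{S_A} inf_{S_B} 𝔼[F(x_τ)]`, as an extended real number. -/
def valueA (F : EuclideanSpace ℝ (Fin n) → ℝ) (x₀ : EuclideanSpace ℝ (Fin n)) : EReal :=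
  ⨆ SA : G.Strategy, ⨅ SB : G.Strategy, ((∫ ω, G.payoff F ω ∂(law SA SB x₀) : ℝ) : EReal)

/-- The value of Player B, `inf_{S_B} sup_{S_A} 𝔼[F(x_τ)]`, as an extended real number. -/
def valueB (F : EuclideanSpace ℝ (Fin n) → ℝ) (x₀ : EuclideanSpace ℝ (Fin n)) : EReal :=
  ⨅ SB : G.Strategy, ⨆ SA : G.Strategy, ((∫ ω, G.payoff F ω ∂(law SA SB x₀) : ℝ) : EReal)

end TugOfWar

end

namespace TugOfWar

variable {n : ℕ} {G : TugOfWar n}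

/-! The mean of `v` after one step has the form of the right side of the dynamic programming
principle, with supremum and infimum replaced by the values at the two players' moves. If Player A
always moves to a point where `v` is within `η / 2 ^ (k + 1)` of its supremum over the ball, the
mean of `v` drops by at most that much in step `k`, whatever B does. The errors sum to at most `η`,
and `v = F` at the exit, so A secures `v x₀ - η`. The same argument for `-v` with the players
exchanged bounds the value of B, and sup-inf is at most inf-sup.

Three points need work. Near-optimal moves must be Borel (`exists_measurable_almost_max`). `v` must
be bounded, which follows from its boundedness on balls by covering `Ω` with finitely many of them.
The game must end almost surely against every pair of strategies (`ae_law_exists_mem_Γ`): the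
uniform move has probability bounded below, and a steep exponential of one coordinate then grows in
mean by a fixed amount per step while staying bounded. -/

/-! ### Measurable selection of near-maximal points -/

/-- A Borel selection of almost maximal points of a bounded function in balls. -/
lemma exists_measurable_almost_max {E : Type*} [PseudoMetricSpace E] [SecondCountableTopology E]
    [Nonempty E] [MeasurableSpace E] [BorelSpace E] {w : E → ℝ} {M : ℝ}
    (hM : ∀ x, w x ≤ M) {r η : ℝ} (hr : 0 < r) (hη : 0 < η) :
    ∃ s : E → E, Measurable s ∧ ∀ x, s x ∈ Metric.ball x r ∧
      ∀ y ∈ Metric.ball x r, w y ≤ w (s x) + η := by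
  classical
  -- The union of balls centred in a superlevel set is open even if that set is wild. By Lindelöf
  -- countably many centres suffice at each rational level, so countably many candidates serve every
  -- `x`.
  have cover : ∀ t : ℚ, ∃ Y ⊆ {y | (t : ℝ) < w y}, Y.Countable ∧
      ⋃ y ∈ Y, Metric.ball y r = ⋃ y ∈ {y | (t : ℝ) < w y}, Metric.ball y r :=
    fun t => TopologicalSpace.isOpen_biUnion_countable _ _ fun _ _ => Metric.isOpen_ball
  choose Y hYsub hYc hYU using cover
  obtain ⟨e, he⟩ : ∃ e : ℕ → E, insert (Classical.arbitrary E) (⋃ t, Y t) = Set.range e :=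
    ((Set.countable_iUnion hYc).insert _).exists_eq_range (Set.insert_nonempty _ _)
  -- Candidate `e i` is good for `x` if it lies in the ball and no point there beats it by more than
  -- `η`; the latter says that `x` avoids an open set, so `P` is Borel in `x`. The first good index
  -- is selected.
  let P : E → ℕ → Prop := fun x i =>
    e i ∈ Metric.ball x r ∧ x ∉ ⋃ y ∈ {y | w (e i) + η < w y}, Metric.ball y r
  have hP : ∀ x, ∃ i, P x i := by
    intro x
    have hne : (w '' Metric.ball x r).Nonempty := ⟨w x, x, Metric.mem_ball_self hr, rfl⟩
    have hbdd : BddAbove (w '' Metric.ball x r) := ⟨M, by rintro _ ⟨y, -, rfl⟩; exact hM y⟩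
    -- A level `t` strictly between supremum minus `η` and supremum: `x` lies in a ball around a
    -- point above `t`, hence around a candidate above `t`.
    obtain ⟨t, ht1, ht2⟩ := exists_rat_btwn (sub_lt_self (sSup (w '' Metric.ball x r)) hη)
    obtain ⟨_, ⟨y, hy, rfl⟩, hty⟩ := exists_lt_of_lt_csSup hne ht2
    have hx : x ∈ ⋃ y ∈ Y t, Metric.ball y r := by
      rw [hYU]
      exact Set.mem_biUnion hty (Metric.mem_ball_comm.mp hy)
    obtain ⟨z, hz, hxz⟩ := Set.mem_iUnion₂.mp hx
    obtain ⟨i, rfl⟩ : z ∈ Set.range e := he ▸ Or.inr (Set.mem_iUnion.mpr ⟨t, hz⟩)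
    refine ⟨i, Metric.mem_ball_comm.mp hxz, fun hx' => ?_⟩
    obtain ⟨u, hu, hxu⟩ := Set.mem_iUnion₂.mp hx'
    have h1 : w u ≤ sSup (w '' Metric.ball x r) :=
      le_csSup hbdd ⟨u, Metric.mem_ball_comm.mp hxu, rfl⟩
    have h2 : (t : ℝ) < w (e i) := hYsub t hz
    have h3 : w (e i) + η < w u := hu
    linarith
  have hPm : ∀ i, MeasurableSet {x | P x i} := fun i => by
    have h1 : MeasurableSet {x | e i ∈ Metric.ball x r} := by
      simp_rw [Metric.mem_ball_comm (x := e i)]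
      exact measurableSet_ball
    exact h1.inter (isOpen_biUnion fun _ _ => Metric.isOpen_ball).measurableSet.compl
  refine ⟨fun x => e (Nat.find (hP x)), (measurable_from_nat (f := e)).comp
    (measurable_find hP hPm), fun x => ⟨(Nat.find_spec (hP x)).1, fun y hy => ?_⟩⟩
  by_contra hlt
  exact (Nat.find_spec (hP x)).2
    (Set.mem_biUnion (not_le.mp hlt) (Metric.mem_ball_comm.mp hy))

/-! ### One step of the game -/

lemma map_law (SA SB : G.Strategy) (x₀ : EuclideanSpace ℝ (Fin n)) (k : ℕ) :
    (law SA SB x₀).map (fun ω => (Preorder.frestrictLe k ω, ω (k + 1))) =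
      ((law SA SB x₀).map (Preorder.frestrictLe k)) ⊗ₘ stepKernel SA SB k := by
  unfold law
  rw [Kernel.traj_map_frestrictLe_apply]
  exact (Kernel.partialTraj_compProd_eq_map_traj (Nat.zero_le k)).symm

instance isProbabilityMeasure_law (SA SB : G.Strategy) (x₀ : EuclideanSpace ℝ (Fin n)) :
    IsProbabilityMeasure (law SA SB x₀) := by
  unfold law
  infer_instance

lemma integrable_of_abs_le {X : Type*} [MeasurableSpace X] {μ : Measure X} [IsFiniteMeasure μ]
    {g : X → ℝ} (hg : Measurable g) {M : ℝ} (hM : ∀ x, |g x| ≤ M) : Integrable g μ :=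
  Integrable.of_bound hg.aestronglyMeasurable M (ae_of_all _ hM)

lemma integral_law_succ (SA SB : G.Strategy) (x₀ : EuclideanSpace ℝ (Fin n)) (k : ℕ)
    {g : EuclideanSpace ℝ (Fin n) → ℝ} (hg : Measurable g) {M : ℝ} (hM : ∀ x, |g x| ≤ M) :
    ∫ ω, g (ω (k + 1)) ∂(law SA SB x₀) =
      ∫ ω, ∫ y, g y ∂(stepLaw SA SB k (Preorder.frestrictLe k ω)) ∂(law SA SB x₀) := by
  have hr : Measurable (Preorder.frestrictLe (π := fun _ => EuclideanSpace ℝ (Fin n)) k) :=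
    Preorder.measurable_frestrictLe k
  have hp : IsProbabilityMeasure ((law SA SB x₀).map (Preorder.frestrictLe k)) :=
    Measure.isProbabilityMeasure_map hr.aemeasurable
  have hm : Measurable fun ω : ℕ → EuclideanSpace ℝ (Fin n) =>
      (Preorder.frestrictLe (π := fun _ => EuclideanSpace ℝ (Fin n)) k ω, ω (k + 1)) :=
    hr.prodMk (measurable_pi_apply _)
  have hg2 : Measurable fun q : History n k × EuclideanSpace ℝ (Fin n) => g q.2 :=
    hg.comp measurable_snd
  have h1 := integral_map (μ := law SA SB x₀) hm.aemeasurable hg2.aestronglyMeasurable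
  rw [map_law, Measure.integral_compProd (integrable_of_abs_le hg2 fun q => hM q.2)] at h1
  rw [← h1, integral_map hr.aemeasurable]
  · rfl
  · exact (hg2.stronglyMeasurable.integral_kernel_prod_right'
      (κ := stepKernel SA SB k)).aestronglyMeasurable

/-- Disintegration over the history: a property of one step that holds almost surely after every
history holds almost surely along the game. -/
lemma ae_law_succ (SA SB : G.Strategy) (x₀ : EuclideanSpace ℝ (Fin n)) (k : ℕ)
    {R : History n k × EuclideanSpace ℝ (Fin n) → Prop} (hR : MeasurableSet {q | R q})
    (h : ∀ z, ∀ᵐ y ∂(stepLaw SA SB k z), R (z, y)) :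
    ∀ᵐ ω ∂(law SA SB x₀), R (Preorder.frestrictLe k ω, ω (k + 1)) := by
  have hr : Measurable (Preorder.frestrictLe (π := fun _ => EuclideanSpace ℝ (Fin n)) k) :=
    Preorder.measurable_frestrictLe k
  have hp : IsProbabilityMeasure ((law SA SB x₀).map (Preorder.frestrictLe k)) :=
    Measure.isProbabilityMeasure_map hr.aemeasurable
  have hm : Measurable fun ω : ℕ → EuclideanSpace ℝ (Fin n) =>
      (Preorder.frestrictLe (π := fun _ => EuclideanSpace ℝ (Fin n)) k ω, ω (k + 1)) :=
    hr.prodMk (measurable_pi_apply _)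
  refine ae_of_ae_map hm.aemeasurable (p := R) ?_
  rw [map_law, Measure.ae_compProd_iff hR]
  exact ae_of_all _ h

lemma ae_law_zero (SA SB : G.Strategy) (x₀ : EuclideanSpace ℝ (Fin n)) :
    ∀ᵐ ω ∂(law SA SB x₀), ω 0 = x₀ := by
  have hr : Measurable (Preorder.frestrictLe (π := fun _ => EuclideanSpace ℝ (Fin n)) 0) :=
    Preorder.measurable_frestrictLe 0
  refine ae_of_ae_map hr.aemeasurable (p := fun z : History n 0 => z.last = x₀) ?_
  unfold law
  rw [Kernel.traj_map_frestrictLe_apply, Kernel.partialTraj_self, Kernel.id_apply]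
  exact (ae_dirac_iff (measurable_last (measurableSet_singleton x₀))).mpr rfl

lemma setAverage_ball_eq (g : EuclideanSpace ℝ (Fin n) → ℝ) (x : EuclideanSpace ℝ (Fin n))
    (r : ℝ) : ⨍ y in Metric.ball x r, g y =
      ⨍ h in Metric.ball (0 : EuclideanSpace ℝ (Fin n)) r, g (x + h) := by
  rw [setAverage_eq, setAverage_eq, measureReal_def, measureReal_def,
    Measure.addHaar_ball_center volume x r]
  have h1 : Metric.ball (0 : EuclideanSpace ℝ (Fin n)) r = (x + ·) ⁻¹' Metric.ball x r := by
    simp [preimage_add_ball]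
  rw [h1, (measurePreserving_add_left volume x).setIntegral_preimage_emb
    (measurableEmbedding_addLeft x)]

lemma stepLaw_of_notMem {SA SB : G.Strategy} {k : ℕ} {z : History n k} (hz : z.last ∉ G.Ω) :
    stepLaw SA SB k z = Measure.dirac z.last := by
  simp [stepLaw, hz]

/-- The link between the game and the dynamic programming principle; boundedness of `g` permits
integrating each summand of the step law separately. -/
lemma integral_stepLaw_of_mem {SA SB : G.Strategy} {k : ℕ} {z : History n k} (hz : z.last ∈ G.Ω)
    {g : EuclideanSpace ℝ (Fin n) → ℝ} (hg : Measurable g) {M : ℝ} (hM : ∀ x, |g x| ≤ M) :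
    ∫ y, g y ∂(stepLaw SA SB k z) =
      G.γ z.last * (G.α / 2) * (g (SA.move k z) + g (SB.move k z))
        + G.γ z.last * G.β * (⨍ h in Metric.ball (0 : EuclideanSpace ℝ (Fin n)) G.ε,
            g (z.last + h)) + G.U g z.last := by
  obtain ⟨g0, g1⟩ := γ_mem hz
  have ha := G.α_pos
  have hb := G.β_pos
  have e1 : (0 : ℝ) ≤ G.γ z.last * G.β := by positivity
  have e2 : (0 : ℝ) ≤ G.γ z.last * (G.α / 2) := by positivity
  have e3 : (0 : ℝ) ≤ 1 - G.γ z.last := by linarith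
  have hball : volume (Metric.ball z.last G.ε) ≠ 0 :=
    (Metric.measure_ball_pos volume z.last G.ε_pos).ne'
  have : IsFiniteMeasure (volume.restrict (Metric.ball z.last G.ε)) :=
    ⟨by simpa using measure_ball_lt_top⟩
  have i0 : Integrable g (volume.restrict (Metric.ball z.last G.ε)) := integrable_of_abs_le hg hM
  have i1 : Integrable g (ENNReal.ofReal (G.γ z.last * G.β) •
      ((volume (Metric.ball z.last G.ε))⁻¹ • volume.restrict (Metric.ball z.last G.ε))) :=
    (i0.smul_measure (ENNReal.inv_ne_top.mpr hball)).smul_measure ENNReal.ofReal_ne_top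
  have i2 : ∀ (c : ℝ) (y), Integrable g (ENNReal.ofReal c • Measure.dirac y) := fun c y =>
    (integrable_of_abs_le hg hM).smul_measure ENNReal.ofReal_ne_top
  have i3 := (i1.add_measure (i2 (G.γ z.last * (G.α / 2)) (SA.move k z)))
  have i4 := (i3.add_measure (i2 (G.γ z.last * (G.α / 2)) (SB.move k z)))
  rw [← setAverage_ball_eq, setAverage_eq']
  unfold stepLaw U
  rw [if_pos hz]
  split_ifs with h0
  · rw [integral_add_measure i4 (i2 _ _), integral_add_measure i3 (i2 _ _),
      integral_add_measure i1 (i2 _ _)]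
    simp only [integral_smul_measure _ (ENNReal.ofReal _), integral_dirac,
      ENNReal.toReal_ofReal e1, ENNReal.toReal_ofReal e2, ENNReal.toReal_ofReal e3, smul_eq_mul]
    ring
  · rw [add_zero, integral_add_measure i3 (i2 _ _),
      integral_add_measure i1 (i2 _ _)]
    simp only [integral_smul_measure _ (ENNReal.ofReal _), integral_dirac,
      ENNReal.toReal_ofReal e1, ENNReal.toReal_ofReal e2, smul_eq_mul]
    ring

/-! ### The board -/

lemma measurableSet_Γ : MeasurableSet G.Γ :=
  G.isOpen_Ω.measurableSet.compl.inter
    (measurableSet_le (Metric.continuous_infDist_pt _).measurable measurable_const)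

lemma measurableSet_board : MeasurableSet G.board :=
  G.isOpen_Ω.measurableSet.union measurableSet_Γ

lemma ball_subset_board {x : EuclideanSpace ℝ (Fin n)} (hx : x ∈ G.Ω) :
    Metric.ball x G.ε ⊆ G.board := by
  intro y hy
  by_cases hyΩ : y ∈ G.Ω
  · exact Or.inl hyΩ
  · exact Or.inr ⟨hyΩ, (Metric.infDist_le_dist_of_mem hx).trans (Metric.mem_ball.mp hy).le⟩

lemma mem_Γ_of_mem_board {x : EuclideanSpace ℝ (Fin n)} (hx : x ∈ G.board) (h : x ∉ G.Ω) :
    x ∈ G.Γ :=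
  hx.resolve_left h

lemma isBounded_board : Bornology.IsBounded G.board := by
  refine G.isBounded_Ω.union ((G.isBounded_Ω.cthickening (δ := G.ε)).subset fun y hy => ?_)
  rw [Metric.mem_cthickening_iff]
  rw [← ENNReal.ofReal_toReal (Metric.infEDist_ne_top G.isConnected_Ω.nonempty)]
  exact ENNReal.ofReal_le_ofReal hy.2

lemma ae_stepLaw_mem_board
    (hdrift : ∀ x ∈ G.Ω, gradient G.f x ≠ 0 → G.driftTarget x ∈ G.board)
    {SA SB : G.Strategy} {k : ℕ} {z : History n k} (hz : z.last ∈ G.board) :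
    ∀ᵐ y ∂(stepLaw SA SB k z), y ∈ G.board := by
  by_cases hzΩ : z.last ∈ G.Ω
  · have hd : ∀ (c : ENNReal) (y), y ∈ G.board → ∀ᵐ u ∂(c • Measure.dirac y), u ∈ G.board :=
      fun c y hy => Measure.ae_smul_measure ((ae_dirac_iff measurableSet_board).mpr hy) c
    unfold stepLaw
    rw [if_pos hzΩ]
    simp only [ae_add_measure_iff]
    refine ⟨⟨⟨?_, hd _ _ (ball_subset_board hzΩ (SA.move_mem k z))⟩,
      hd _ _ (ball_subset_board hzΩ (SB.move_mem k z))⟩, ?_⟩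
    · refine Measure.ae_smul_measure (Measure.ae_smul_measure ?_ _) _
      filter_upwards [ae_restrict_mem measurableSet_ball] with y hy using
        ball_subset_board hzΩ hy
    · split_ifs with h0
      · exact hd _ _ (hdrift _ hzΩ h0)
      · simp
  · rw [stepLaw_of_notMem hzΩ]
    exact (ae_dirac_iff measurableSet_board).mpr hz

lemma ae_law_mem_board
    (hdrift : ∀ x ∈ G.Ω, gradient G.f x ≠ 0 → G.driftTarget x ∈ G.board)
    (SA SB : G.Strategy) {x₀ : EuclideanSpace ℝ (Fin n)} (hx₀ : x₀ ∈ G.board) :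
    ∀ᵐ ω ∂(law SA SB x₀), ∀ k, ω k ∈ G.board := by
  have hstep : ∀ᵐ ω ∂(law SA SB x₀), ∀ k, ω k ∈ G.board → ω (k + 1) ∈ G.board := by
    refine ae_all_iff.mpr fun k => ae_law_succ SA SB x₀ k
      (R := fun q => q.1.last ∈ G.board → q.2 ∈ G.board) ?_ fun z => ?_
    · exact ((measurable_last.comp measurable_fst) measurableSet_board).imp
        (measurable_snd measurableSet_board)
    · by_cases hz : z.last ∈ G.board
      · filter_upwards [ae_stepLaw_mem_board hdrift hz] with y hy _ using hy
      · exact ae_of_all _ fun _ h => absurd h hz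
  filter_upwards [hstep, ae_law_zero SA SB x₀] with ω hω h0 k
  induction k with
  | zero => rwa [h0]
  | succ k ih => exact hω k ih

lemma ae_law_stay (SA SB : G.Strategy) (x₀ : EuclideanSpace ℝ (Fin n)) :
    ∀ᵐ ω ∂(law SA SB x₀), ∀ k, ω k ∉ G.Ω → ∀ j ≥ k, ω j = ω k := by
  have hstep : ∀ᵐ ω ∂(law SA SB x₀), ∀ k, ω k ∉ G.Ω → ω (k + 1) = ω k := by
    refine ae_all_iff.mpr fun k => ae_law_succ SA SB x₀ k
      (R := fun q => q.1.last ∉ G.Ω → q.2 = q.1.last) ?_ fun z => ?_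
    · exact ((measurable_last.comp measurable_fst) G.isOpen_Ω.measurableSet.compl).imp
        (measurableSet_eq_fun measurable_snd (measurable_last.comp measurable_fst))
    · by_cases hz : z.last ∈ G.Ω
      · exact ae_of_all _ fun _ h => absurd hz h
      · rw [stepLaw_of_notMem hz]
        filter_upwards [(ae_dirac_iff (measurableSet_singleton z.last)).mpr rfl] with y hy _
        exact hy
  filter_upwards [hstep] with ω hω k hk j hj
  induction j, hj using Nat.le_induction with
  | base => rfl
  | succ j hj ih => rw [hω j (ih ▸ hk), ih]
/-- A function satisfying the dynamic programming principle is bounded on the board. -/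
lemma SatisfiesDPP.exists_abs_le {v F : EuclideanSpace ℝ (Fin n) → ℝ} (hDPP : G.SatisfiesDPP v)
    (hvF : ∀ x ∈ G.Γ, v x = F x) (hFb : ∃ C : ℝ, ∀ x ∈ G.Γ, |F x| ≤ C) :
    ∃ M : ℝ, ∀ x ∈ G.board, |v x| ≤ M := by
  obtain ⟨C, hC⟩ := hFb
  -- Finitely many `ε`-balls with centres in `Ω` cover `Ω`, and `v` is bounded on each by the
  -- finiteness clauses at its centre.
  obtain ⟨t, htΩ, htf, htc⟩ := Metric.finite_approx_of_totallyBounded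
    (G.isBounded_Ω.isCompact_closure.totallyBounded.subset subset_closure) G.ε G.ε_pos
  have hb1 : BddAbove (⋃ x ∈ t, v '' Metric.ball x G.ε) :=
    htf.bddAbove_biUnion.mpr fun x hx => (hDPP x (htΩ hx)).1
  have hb2 : BddBelow (⋃ x ∈ t, v '' Metric.ball x G.ε) :=
    htf.bddBelow_biUnion.mpr fun x hx => (hDPP x (htΩ hx)).2.1
  obtain ⟨a, ha⟩ := hb1
  obtain ⟨b, hb⟩ := hb2
  refine ⟨max C (max a (-b)), fun x hx => ?_⟩
  rcases hx with hx | hx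
  · obtain ⟨y, hy, hxy⟩ := Set.mem_iUnion₂.mp (htc hx)
    have hmem : v x ∈ ⋃ x ∈ t, v '' Metric.ball x G.ε := Set.mem_biUnion hy ⟨x, hxy, rfl⟩
    have h1 := ha hmem
    have h2 := hb hmem
    refine le_trans (abs_le.mpr ⟨?_, ?_⟩) (le_max_right _ _)
    · linarith [le_max_right a (-b)]
    · exact h1.trans (le_max_left _ _)
  · rw [hvF x hx]
    exact (hC x hx).trans (le_max_left _ _)

/-! ### Almost sure termination -/

/-- `γ` increases with `f` and decreases with the gradient norm, so the lower bound of `f` and the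
upper bound of the gradient give the worst case. -/
lemma exists_pos_le_γ (hDf : ∃ C : ℝ, ∀ x ∈ G.Ω, ‖gradient G.f x‖ ≤ C) :
    ∃ c > 0, ∀ x ∈ G.Ω, c ≤ G.γ x := by
  obtain ⟨C, hC⟩ := hDf
  obtain ⟨c, hc, hf⟩ := G.f_lower
  have hp : 0 < 2 * (G.p + n) := by
    have h2 := G.two_lt_p
    have hn : (0 : ℝ) ≤ n := Nat.cast_nonneg n
    linarith
  obtain ⟨y, hy⟩ := G.isConnected_Ω.nonempty
  have hA : 0 ≤ C / (2 * (G.p + n)) := div_nonneg ((norm_nonneg _).trans (hC y hy)) hp.le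
  refine ⟨c / (C / (2 * (G.p + n)) + c), by positivity, fun x hx => ?_⟩
  have hfx := hf x hx
  have hA' : ‖gradient G.f x‖ / (2 * (G.p + n)) ≤ C / (2 * (G.p + n)) := by
    gcongr
    exact hC x hx
  have hA0 : 0 ≤ ‖gradient G.f x‖ / (2 * (G.p + n)) := by positivity
  unfold γ
  rw [div_le_div_iff₀ (by positivity) (by linarith)]
  nlinarith [mul_le_mul hfx hA' hA0 (hc.le.trans hfx)]

/-- A bounded function that increases by a fixed amount on average in every step of the game. -/
lemma exists_escape_function (hDf : ∃ C : ℝ, ∀ x ∈ G.Ω, ‖gradient G.f x‖ ≤ C) :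
    ∃ (φ : EuclideanSpace ℝ (Fin n) → ℝ) (M m : ℝ), Measurable φ ∧ (∀ x, |φ x| ≤ M) ∧ 0 < m ∧
      ∀ (SA SB : G.Strategy) (k : ℕ) (z : History n k), z.last ∈ G.Ω →
        φ z.last + m ≤ ∫ y, φ y ∂(stepLaw SA SB k z) := by
  obtain ⟨c, hc, hcγ⟩ := exists_pos_le_γ hDf
  obtain ⟨R, hR⟩ := (isBounded_board (G := G)).exists_norm_le
  have hε := G.ε_pos
  have hα := G.α_pos
  have hβ := G.β_pos
  let i : Fin n := ⟨0, G.one_le_n⟩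
  let B : ℝ → Set (EuclideanSpace ℝ (Fin n)) := Metric.ball 0
  have hvol : ∀ r, 0 < r → 0 < volume.real (B r) := fun r hr =>
    ENNReal.toReal_pos (Metric.measure_ball_pos volume _ hr).ne' measure_ball_lt_top.ne
  have hV := hvol _ hε
  have hv := hvol (G.ε / 4) (by linarith)
  -- `q` is the chance that a uniform point of an `ε`-ball hits a given `ε/4`-ball inside it.
  obtain ⟨q, hq⟩ : ∃ q, q = volume.real (B (G.ε / 4)) / volume.real (B G.ε) := ⟨_, rfl⟩
  have hq0 : 0 < q := hq ▸ div_pos hv hV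
  -- Here `l * (ε / 2)` equals `s = 2 / (c * β * q)`, and `exp s ≥ s`. The constant 2 makes the
  -- uniform move alone at least double `φ` in mean; the other moves contribute nonnegatively.
  obtain ⟨l, hl0, hl⟩ : ∃ l : ℝ, 0 < l ∧ 2 ≤ c * G.β * q * Real.exp (l * (G.ε / 2)) := by
    refine ⟨2 / (c * G.β * q) * (2 / G.ε), by positivity, ?_⟩
    have h1 := Real.add_one_le_exp (2 / (c * G.β * q))
    have h2 : 2 / (c * G.β * q) * (2 / G.ε) * (G.ε / 2) = 2 / (c * G.β * q) := by
      field_simp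
    rw [h2]
    calc (2 : ℝ) = c * G.β * q * (2 / (c * G.β * q)) := by field_simp
      _ ≤ _ := by gcongr; linarith
  let ψ : EuclideanSpace ℝ (Fin n) → ℝ := fun x => Real.exp (l * x i)
  let φ : EuclideanSpace ℝ (Fin n) → ℝ := G.board.indicator ψ
  have hψm : Measurable ψ := by
    have : Continuous ψ := by fun_prop
    exact this.measurable
  have hφm : Measurable φ := hψm.indicator measurableSet_board
  have hcoord : ∀ x ∈ G.board, |x i| ≤ R := fun x hx =>
    (PiLp.norm_apply_le x i).trans (hR x hx)
  have hφ0 : ∀ x, 0 ≤ φ x := fun x => Set.indicator_nonneg (fun _ _ => (Real.exp_pos _).le) x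
  have hφM : ∀ x, |φ x| ≤ Real.exp (l * R) := by
    intro x
    rw [abs_of_nonneg (hφ0 x)]
    by_cases hx : x ∈ G.board
    · simp only [φ, Set.indicator_of_mem hx]
      exact Real.exp_le_exp.mpr (mul_le_mul_of_nonneg_left (abs_le.mp (hcoord x hx)).2 hl0.le)
    · simp only [φ, Set.indicator_of_notMem hx]
      exact (Real.exp_pos _).le
  refine ⟨φ, _, Real.exp (l * (-R)), hφm, hφM, Real.exp_pos _, fun SA SB k z hz => ?_⟩
  obtain ⟨g0, g1⟩ := γ_mem hz
  rw [integral_stepLaw_of_mem hz hφm hφM, ← setAverage_ball_eq]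
  have hU : 0 ≤ G.U φ z.last := by
    unfold U
    split_ifs
    · exact mul_nonneg (by linarith) (hφ0 _)
    · exact le_rfl
  have hS : 0 ≤ G.γ z.last * (G.α / 2) * (φ (SA.move k z) + φ (SB.move k z)) :=
    mul_nonneg (by positivity) (add_nonneg (hφ0 _) (hφ0 _))
  have hzφ : φ z.last = ψ z.last := Set.indicator_of_mem (s := G.board) (Or.inl hz) _
  have hzm : Real.exp (l * (-R)) ≤ ψ z.last :=
    Real.exp_le_exp.mpr (mul_le_mul_of_nonneg_left
      (abs_le.mp (hcoord _ (Or.inl hz))).1 hl0.le)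
  have hψz : 0 < ψ z.last := Real.exp_pos _
  -- The `ε/4`-ball around `x'` lies in the `ε`-ball of the token, and all its points are ahead by
  -- at least `ε/2` in coordinate `i`.
  let x' : EuclideanSpace ℝ (Fin n) := z.last + EuclideanSpace.single i (3 / 4 * G.ε)
  have hsub : Metric.ball x' (G.ε / 4) ⊆ Metric.ball z.last G.ε := by
    refine Metric.ball_subset_ball' ?_
    have : dist x' z.last = 3 / 4 * G.ε := by
      simp [x', abs_of_pos hε]
    linarith
  have hge : ∀ y ∈ Metric.ball x' (G.ε / 4), Real.exp (l * (G.ε / 2)) * ψ z.last ≤ φ y := by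
    intro y hy
    have h1 : |y i - x' i| < G.ε / 4 := by
      refine lt_of_le_of_lt (PiLp.norm_apply_le (y - x') i) ?_
      rwa [← dist_eq_norm]
    have h2 : x' i = z.last i + 3 / 4 * G.ε := by simp [x']
    have h3 := (abs_lt.mp h1).1
    have h4 : φ y = ψ y := Set.indicator_of_mem (ball_subset_board hz (hsub hy)) _
    rw [h4, ← Real.exp_add]
    refine Real.exp_le_exp.mpr ?_
    rw [← mul_add]
    exact mul_le_mul_of_nonneg_left (by linarith) hl0.le
  have hfin : ∀ (x : EuclideanSpace ℝ (Fin n)) (r : ℝ),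
      IsFiniteMeasure (volume.restrict (Metric.ball x r)) := fun x r =>
    ⟨by simpa using measure_ball_lt_top⟩
  have hint : ∀ (x : EuclideanSpace ℝ (Fin n)) (r : ℝ), IntegrableOn φ (Metric.ball x r) :=
    fun x r => have := hfin x r; integrable_of_abs_le hφm hφM
  have havg : q * (Real.exp (l * (G.ε / 2)) * ψ z.last) ≤
      ⨍ y in Metric.ball z.last G.ε, φ y := by
    have h1 : Real.exp (l * (G.ε / 2)) * ψ z.last * volume.real (Metric.ball x' (G.ε / 4)) ≤
        ∫ y in Metric.ball x' (G.ε / 4), φ y :=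
      setIntegral_ge_of_const_le_real measurableSet_ball measure_ball_lt_top.ne hge
        (hint _ _)
    have h2 : ∫ y in Metric.ball x' (G.ε / 4), φ y ≤ ∫ y in Metric.ball z.last G.ε, φ y :=
      setIntegral_mono_set (hint _ _) (ae_of_all _ hφ0) hsub.eventuallyLE
    have h3 : ∀ (x : EuclideanSpace ℝ (Fin n)) (r : ℝ),
        volume.real (Metric.ball x r) = volume.real (B r) := fun x r => by
      simp only [measureReal_def, B, Measure.addHaar_ball_center volume x r]
    rw [h3] at h1
    rw [setAverage_eq, h3, smul_eq_mul, hq, div_mul_eq_mul_div, div_eq_inv_mul]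
    refine mul_le_mul_of_nonneg_left ?_ (inv_nonneg.mpr hV.le)
    linarith
  have hmain : 2 * ψ z.last ≤ G.γ z.last * G.β * ⨍ y in Metric.ball z.last G.ε, φ y :=
    calc 2 * ψ z.last ≤ c * G.β * q * Real.exp (l * (G.ε / 2)) * ψ z.last := by gcongr
      _ = c * G.β * (q * (Real.exp (l * (G.ε / 2)) * ψ z.last)) := by ring
      _ ≤ _ := by
        gcongr
        exact hcγ _ hz
  rw [hzφ]
  linarith

lemma integral_stepLaw_of_notMem {SA SB : G.Strategy} {k : ℕ} {z : History n k}
    (hz : z.last ∉ G.Ω) (g : EuclideanSpace ℝ (Fin n) → ℝ) :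
    ∫ y, g y ∂(stepLaw SA SB k z) = g z.last := by
  rw [stepLaw_of_notMem hz, integral_dirac]

lemma integrable_law_comp (SA SB : G.Strategy) (x₀ : EuclideanSpace ℝ (Fin n)) (k : ℕ)
    {g : EuclideanSpace ℝ (Fin n) → ℝ} (hg : Measurable g) {M : ℝ} (hM : ∀ x, |g x| ≤ M) :
    Integrable (fun ω => g (ω k)) (law SA SB x₀) :=
  integrable_of_abs_le (hg.comp (measurable_pi_apply k)) fun ω => hM (ω k)

/-- A pointwise bound for the mean increment in one step gives a bound for the increment of the
expectation. -/
lemma integral_law_add_le (SA SB : G.Strategy) (x₀ : EuclideanSpace ℝ (Fin n)) (k : ℕ)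
    {g d : EuclideanSpace ℝ (Fin n) → ℝ} (hg : Measurable g) {M : ℝ} (hM : ∀ x, |g x| ≤ M)
    (hd : Measurable d) {D : ℝ} (hD : ∀ x, |d x| ≤ D)
    (h : ∀ z : History n k, g z.last + d z.last ≤ ∫ y, g y ∂(stepLaw SA SB k z)) :
    ∫ ω, g (ω k) ∂(law SA SB x₀) + ∫ ω, d (ω k) ∂(law SA SB x₀) ≤
      ∫ ω, g (ω (k + 1)) ∂(law SA SB x₀) := by
  rw [integral_law_succ SA SB x₀ k hg hM, ← integral_add (integrable_law_comp SA SB x₀ k hg hM)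
    (integrable_law_comp SA SB x₀ k hd hD)]
  refine integral_mono ((integrable_law_comp SA SB x₀ k hg hM).add
    (integrable_law_comp SA SB x₀ k hd hD)) ?_ fun ω => h (Preorder.frestrictLe k ω)
  have hm : Measurable fun z : History n k => ∫ y, g y ∂(stepLaw SA SB k z) :=
    ((hg.comp measurable_snd).stronglyMeasurable.integral_kernel_prod_right'
      (κ := stepKernel SA SB k)).measurable
  refine integrable_of_abs_le (hm.comp (Preorder.measurable_frestrictLe k)) (M := M) fun ω => ?_
  have := norm_integral_le_of_norm_le_const (μ := stepLaw SA SB k (Preorder.frestrictLe k ω))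
    (f := g) (ae_of_all _ hM)
  simpa using this

/-- Let `p` be the probability of staying in `Ω` forever. The mean of the escape function rises by
at least `m * p` in every step but stays bounded, so `p = 0`. -/
lemma ae_law_exists_mem_Γ (hDf : ∃ C : ℝ, ∀ x ∈ G.Ω, ‖gradient G.f x‖ ≤ C)
    (hdrift : ∀ x ∈ G.Ω, gradient G.f x ≠ 0 → G.driftTarget x ∈ G.board)
    (SA SB : G.Strategy) {x₀ : EuclideanSpace ℝ (Fin n)} (hx₀ : x₀ ∈ G.board) :
    ∀ᵐ ω ∂(law SA SB x₀), ∃ k, ω k ∈ G.Γ := by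
  obtain ⟨φ, M, m, hφ, hM, hm, hstep⟩ := exists_escape_function hDf
  have hmeas : ∀ k, MeasurableSet {ω : ℕ → EuclideanSpace ℝ (Fin n) | ω k ∈ G.Ω} := fun k =>
    measurable_pi_apply k G.isOpen_Ω.measurableSet
  let p := (law SA SB x₀).real {ω | ∀ k, ω k ∈ G.Ω}
  have hinc : ∀ k, ∫ ω, φ (ω k) ∂(law SA SB x₀) + m * p ≤
      ∫ ω, φ (ω (k + 1)) ∂(law SA SB x₀) := by
    intro k
    -- Off `Ω` the token is frozen, so the guaranteed increment there is zero.
    let d : EuclideanSpace ℝ (Fin n) → ℝ := G.Ω.indicator fun _ => m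
    have hd : ∀ x, |d x| ≤ m := fun x => by
      by_cases hx : x ∈ G.Ω <;> simp [d, hx, abs_of_pos hm, hm.le]
    have h1 := integral_law_add_le SA SB x₀ k hφ hM
      (measurable_const.indicator G.isOpen_Ω.measurableSet) hd fun z => by
        by_cases hz : z.last ∈ G.Ω
        · simpa [d, hz] using hstep SA SB k z hz
        · simp [hz, integral_stepLaw_of_notMem hz]
    have h2 : ∫ ω, d (ω k) ∂(law SA SB x₀) =
        m * (law SA SB x₀).real {ω | ω k ∈ G.Ω} := by
      have : (fun ω : ℕ → EuclideanSpace ℝ (Fin n) => d (ω k)) =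
          {ω | ω k ∈ G.Ω}.indicator fun _ => m := rfl
      rw [this, integral_indicator_const _ (hmeas k), smul_eq_mul, mul_comm]
    have h3 : p ≤ (law SA SB x₀).real {ω | ω k ∈ G.Ω} :=
      measureReal_mono fun ω hω => hω k
    rw [h2] at h1
    nlinarith
  have hsum : ∀ k : ℕ, ∫ ω, φ (ω 0) ∂(law SA SB x₀) + k * (m * p) ≤
      ∫ ω, φ (ω k) ∂(law SA SB x₀) := by
    intro k
    induction k with
    | zero => simp
    | succ k ih =>
      push_cast
      linarith [hinc k]
  have hbd : ∀ k, |∫ ω, φ (ω k) ∂(law SA SB x₀)| ≤ M := fun k => by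
    have := norm_integral_le_of_norm_le_const (μ := law SA SB x₀)
      (f := fun ω => φ (ω k)) (ae_of_all _ fun ω => hM (ω k))
    simpa using this
  have hp : p = 0 := by
    by_contra hp
    have hp0 : 0 < p := lt_of_le_of_ne measureReal_nonneg (Ne.symm hp)
    obtain ⟨N, hN⟩ := exists_nat_gt (2 * M / (m * p))
    rw [div_lt_iff₀ (by positivity)] at hN
    linarith [hsum N, (abs_le.mp (hbd 0)).1, (abs_le.mp (hbd N)).2]
  have hnull : ∀ᵐ ω ∂(law SA SB x₀), ¬ ∀ k, ω k ∈ G.Ω := by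
    rw [ae_iff]
    simpa only [not_not] using (measureReal_eq_zero_iff).mp hp
  filter_upwards [hnull, ae_law_mem_board hdrift SA SB hx₀] with ω h1 h2
  obtain ⟨k, hk⟩ := not_forall.mp h1
  exact ⟨k, mem_Γ_of_mem_board (h2 k) hk⟩

/-! ### Convergence to the payoff -/

section Payoff

variable {w F : EuclideanSpace ℝ (Fin n) → ℝ} {M : ℝ}

lemma ae_tendsto_payoff (hDf : ∃ C : ℝ, ∀ x ∈ G.Ω, ‖gradient G.f x‖ ≤ C)
    (hdrift : ∀ x ∈ G.Ω, gradient G.f x ≠ 0 → G.driftTarget x ∈ G.board)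
    (hwF : ∀ x ∈ G.Γ, w x = F x)
    (SA SB : G.Strategy) {x₀ : EuclideanSpace ℝ (Fin n)} (hx₀ : x₀ ∈ G.board) :
    ∀ᵐ ω ∂(law SA SB x₀),
      Filter.Tendsto (fun k => w (ω k)) Filter.atTop (nhds (G.payoff F ω)) := by
  filter_upwards [ae_law_exists_mem_Γ hDf hdrift SA SB hx₀, ae_law_stay SA SB x₀] with ω h1 h2
  -- Termination excludes the empty set, where `sInf` would return the meaningless time 0.
  have hτ : ω (G.exitTime ω) ∈ G.Γ := Nat.sInf_mem (s := {k | ω k ∈ G.Γ}) h1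
  refine tendsto_const_nhds.congr' ?_
  filter_upwards [Filter.eventually_ge_atTop (G.exitTime ω)] with k hk
  rw [h2 _ hτ.1 k hk, hwF _ hτ, payoff]

/-- The payoff is an almost sure limit of the bounded measurable functions `w (ω k)`, which gives
both measurability and the bound. -/
lemma integrable_payoff (hDf : ∃ C : ℝ, ∀ x ∈ G.Ω, ‖gradient G.f x‖ ≤ C)
    (hdrift : ∀ x ∈ G.Ω, gradient G.f x ≠ 0 → G.driftTarget x ∈ G.board)
    (hw : Measurable w) (hM : ∀ x, |w x| ≤ M) (hwF : ∀ x ∈ G.Γ, w x = F x)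
    (SA SB : G.Strategy) {x₀ : EuclideanSpace ℝ (Fin n)} (hx₀ : x₀ ∈ G.board) :
    Integrable (G.payoff F) (law SA SB x₀) := by
  have hlim := ae_tendsto_payoff hDf hdrift hwF SA SB hx₀
  refine Integrable.of_bound (aestronglyMeasurable_of_tendsto_ae Filter.atTop
    (fun k => (hw.comp (measurable_pi_apply k)).aestronglyMeasurable) hlim) M ?_
  filter_upwards [hlim] with ω hω
  exact le_of_tendsto hω.norm (Filter.Eventually.of_forall fun k => hM (ω k))

lemma tendsto_integral_payoff (hDf : ∃ C : ℝ, ∀ x ∈ G.Ω, ‖gradient G.f x‖ ≤ C)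
    (hdrift : ∀ x ∈ G.Ω, gradient G.f x ≠ 0 → G.driftTarget x ∈ G.board)
    (hw : Measurable w) (hM : ∀ x, |w x| ≤ M) (hwF : ∀ x ∈ G.Γ, w x = F x)
    (SA SB : G.Strategy) {x₀ : EuclideanSpace ℝ (Fin n)} (hx₀ : x₀ ∈ G.board) :
    Filter.Tendsto (fun k => ∫ ω, w (ω k) ∂(law SA SB x₀)) Filter.atTop
      (nhds (∫ ω, G.payoff F ω ∂(law SA SB x₀))) :=
  tendsto_integral_of_dominated_convergence (fun _ => M)
    (fun k => (hw.comp (measurable_pi_apply k)).aestronglyMeasurable)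
    (integrable_const M) (fun k => ae_of_all _ fun ω => hM (ω k))
    (ae_tendsto_payoff hDf hdrift hwF SA SB hx₀)

/-- If in step `k` of the game the mean of `w` decreases by at most `η / 2 ^ (k + 1)`, then the
expected payoff is at least `w x₀ - η`. -/
lemma sub_le_integral_payoff (hDf : ∃ C : ℝ, ∀ x ∈ G.Ω, ‖gradient G.f x‖ ≤ C)
    (hdrift : ∀ x ∈ G.Ω, gradient G.f x ≠ 0 → G.driftTarget x ∈ G.board)
    (hw : Measurable w) (hM : ∀ x, |w x| ≤ M) (hwF : ∀ x ∈ G.Γ, w x = F x)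
    (SA SB : G.Strategy) {x₀ : EuclideanSpace ℝ (Fin n)} (hx₀ : x₀ ∈ G.board) {η : ℝ}
    (hη : 0 ≤ η)
    (h : ∀ k, ∀ z : History n k, z.last ∈ G.Ω →
      w z.last - η / 2 ^ (k + 1) ≤ ∫ y, w y ∂(stepLaw SA SB k z)) :
    w x₀ - η ≤ ∫ ω, G.payoff F ω ∂(law SA SB x₀) := by
  have hstep : ∀ k, ∫ ω, w (ω k) ∂(law SA SB x₀) - η / 2 ^ (k + 1) ≤
      ∫ ω, w (ω (k + 1)) ∂(law SA SB x₀) := by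
    intro k
    have := integral_law_add_le SA SB x₀ k hw hM
      (measurable_const (a := -(η / 2 ^ (k + 1)))) (fun _ => le_rfl) fun z => by
        by_cases hz : z.last ∈ G.Ω
        · simpa [sub_eq_add_neg] using h k z hz
        · rw [integral_stepLaw_of_notMem hz]
          have : 0 ≤ η / 2 ^ (k + 1) := by positivity
          linarith
    simpa [sub_eq_add_neg] using this
  have h0 : ∫ ω, w (ω 0) ∂(law SA SB x₀) = w x₀ := by
    rw [integral_congr_ae (g := fun _ => w x₀)]
    · simp
    · filter_upwards [ae_law_zero SA SB x₀] with ω hω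
      rw [hω]
  have hk : ∀ k, w x₀ - η * (1 - 1 / 2 ^ k) ≤ ∫ ω, w (ω k) ∂(law SA SB x₀) := by
    intro k
    induction k with
    | zero => simp [h0]
    | succ k ih =>
      have e : η * (1 - 1 / 2 ^ (k + 1)) = η * (1 - 1 / 2 ^ k) + η / 2 ^ (k + 1) := by
        rw [pow_succ]
        field_simp
        ring
      linarith [hstep k]
  refine ge_of_tendsto' (tendsto_integral_payoff hDf hdrift hw hM hwF SA SB hx₀) fun k => ?_
  have : 0 ≤ η * (1 / 2 ^ k) := by positivity
  linarith [hk k]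

end Payoff

/-! ### Almost optimal strategies -/

lemma exists_strategy_almost_max {w : EuclideanSpace ℝ (Fin n) → ℝ} {M : ℝ}
    (hM : ∀ x, w x ≤ M) {η : ℝ} (hη : 0 < η) :
    ∃ S : G.Strategy, ∀ k (z : History n k), ∀ y ∈ Metric.ball z.last G.ε,
      w y ≤ w (S.move k z) + η / 2 ^ (k + 1) := by
  have hk : ∀ k : ℕ, 0 < η / 2 ^ (k + 1) := fun k => by positivity
  choose s hs hs' using fun k => exists_measurable_almost_max hM G.ε_pos (hk k)
  exact ⟨⟨fun k z => s k z.last, fun k => (hs k).comp measurable_last,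
    fun k z => (hs' k z.last).1⟩, fun k z => (hs' k z.last).2⟩

/-- A's move loses at most `δ` against the supremum, and any move of B is at least the infimum. The
error enters with weight `γ * (α / 2) ≤ 1`. -/
lemma sub_le_integral_stepLaw_of_max {w : EuclideanSpace ℝ (Fin n) → ℝ} {M : ℝ}
    (hw : Measurable w) (hM : ∀ x, |w x| ≤ M) (hDPP : G.SatisfiesDPP w) {SA SB : G.Strategy}
    {k : ℕ} {z : History n k} (hz : z.last ∈ G.Ω) {δ : ℝ} (hδ : 0 ≤ δ)
    (h : ∀ y ∈ Metric.ball z.last G.ε, w y ≤ w (SA.move k z) + δ) :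
    w z.last - δ ≤ ∫ y, w y ∂(stepLaw SA SB k z) := by
  obtain ⟨-, hb, heq⟩ := hDPP z.last hz
  obtain ⟨g0, g1⟩ := γ_mem hz
  have hα := G.α_pos
  have hβ := G.β_pos
  have hα1 : G.α < 1 := by unfold β at hβ; linarith
  have h1 : sSup (w '' Metric.ball z.last G.ε) ≤ w (SA.move k z) + δ :=
    csSup_le ⟨_, _, Metric.mem_ball_self G.ε_pos, rfl⟩ (by rintro _ ⟨y, hy, rfl⟩; exact h y hy)
  have h2 : sInf (w '' Metric.ball z.last G.ε) ≤ w (SB.move k z) :=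
    csInf_le hb ⟨_, SB.move_mem k z, rfl⟩
  have hc0 : 0 ≤ G.γ z.last * (G.α / 2) := by positivity
  have hc1 : G.γ z.last * (G.α / 2) ≤ 1 :=
    mul_le_one₀ g1 (by positivity) (by linarith)
  rw [integral_stepLaw_of_mem hz hw hM]
  nlinarith [mul_le_mul_of_nonneg_left (add_le_add h1 h2) hc0,
    mul_le_mul_of_nonneg_right hc1 hδ]

/-- Supremum and infimum have equal weight and are exchanged by negation. With `stepLaw_comm`, this
turns A's estimate into B's. -/
lemma SatisfiesDPP.neg {w : EuclideanSpace ℝ (Fin n) → ℝ} (h : G.SatisfiesDPP w) :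
    G.SatisfiesDPP (-w) := by
  intro x hx
  obtain ⟨h1, h2, h3⟩ := h x hx
  have himg : (-w) '' Metric.ball x G.ε = -(w '' Metric.ball x G.ε) := by
    rw [← Set.image_neg_eq_neg, Set.image_image]
    rfl
  have hav : ⨍ h in Metric.ball (0 : EuclideanSpace ℝ (Fin n)) G.ε, (-w) (x + h) =
      -⨍ h in Metric.ball (0 : EuclideanSpace ℝ (Fin n)) G.ε, w (x + h) := by
    simp only [Pi.neg_apply, average_neg]
  have hU : G.U (-w) x = -G.U w x := by
    unfold U
    split_ifs <;> simp
  rw [himg, hav, hU]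
  refine ⟨h2.neg, h1.neg, ?_⟩
  rw [Real.sSup_neg, Real.sInf_neg, Pi.neg_apply, h3]
  ring

lemma stepLaw_comm (SA SB : G.Strategy) : stepLaw SA SB = stepLaw SB SA := by
  funext k z
  unfold stepLaw
  split_ifs
  · congr 1
    rw [add_right_comm]
  · rw [add_zero, add_zero, add_right_comm]
  · rfl

/-- Extending by zero a function outside the board does not affect the dynamic programming
principle. -/
lemma SatisfiesDPP.indicator_board
    (hdrift : ∀ x ∈ G.Ω, gradient G.f x ≠ 0 → G.driftTarget x ∈ G.board)
    {v : EuclideanSpace ℝ (Fin n) → ℝ} (h : G.SatisfiesDPP v) :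
    G.SatisfiesDPP (G.board.indicator v) := by
  intro x hx
  have heq : ∀ y ∈ Metric.ball x G.ε, G.board.indicator v y = v y := fun y hy =>
    Set.indicator_of_mem (ball_subset_board hx hy) v
  have himg : G.board.indicator v '' Metric.ball x G.ε = v '' Metric.ball x G.ε :=
    Set.image_congr heq
  have hav : ⨍ h in Metric.ball (0 : EuclideanSpace ℝ (Fin n)) G.ε, G.board.indicator v (x + h) =
      ⨍ h in Metric.ball (0 : EuclideanSpace ℝ (Fin n)) G.ε, v (x + h) := by
    rw [← setAverage_ball_eq, ← setAverage_ball_eq]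
    exact setAverage_congr_fun measurableSet_ball (ae_of_all _ heq)
  have hU : G.U (G.board.indicator v) x = G.U v x := by
    unfold U
    split_ifs with h0
    · rw [Set.indicator_of_mem (hdrift x hx h0)]
    · rfl
  rw [himg, hav, hU, Set.indicator_of_mem (s := G.board) (Or.inl hx)]
  exact h x hx

end TugOfWar

open TugOfWar in
theorem lemma3p3 {n : ℕ} (G : TugOfWar n)
    -- the gradient of the weight is bounded in the domain
    (hDf : ∃ C : ℝ, ∀ x ∈ G.Ω, ‖gradient G.f x‖ ≤ C)
    -- the gradient move keeps the token in `Ω ∪ Γ_ε` (automatic if `ε ≤ 1`)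
    (hdrift : ∀ x ∈ G.Ω, gradient G.f x ≠ 0 → G.driftTarget x ∈ G.board)
    (F : EuclideanSpace ℝ (Fin n) → ℝ) (hF : Measurable F)
    (hFb : ∃ C : ℝ, ∀ x ∈ G.Γ, |F x| ≤ C)
    (v : EuclideanSpace ℝ (Fin n) → ℝ) (hv : Measurable v)
    (hDPP : G.SatisfiesDPP v) (hvF : ∀ x ∈ G.Γ, v x = F x) :
    -- the expected payoffs are well defined: the token almost surely exits, `F(x_τ)` is integrable
    (∀ x₀ ∈ G.board, ∀ SA SB : G.Strategy,
      (∀ᵐ ω ∂(TugOfWar.law SA SB x₀), ∃ k, ω k ∈ G.Γ) ∧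
        MeasureTheory.Integrable (G.payoff F) (TugOfWar.law SA SB x₀)) ∧
    -- the values of both players are equal to `v`; in particular the game has a value
    (∀ x₀ ∈ G.board,
      G.valueA F x₀ = (v x₀ : EReal) ∧ G.valueB F x₀ = (v x₀ : EReal) ∧
        G.valueA F x₀ = G.valueB F x₀) := by
  obtain ⟨M, hM⟩ := hDPP.exists_abs_le hvF hFb
  -- Outside the board `v` is arbitrary; cutting it off gives a globally bounded function without
  -- changing the game.
  let w := G.board.indicator v
  have hwv : ∀ x ∈ G.board, w x = v x := fun x hx => Set.indicator_of_mem hx v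
  have hw : Measurable w := hv.indicator measurableSet_board
  have hwM : ∀ x, |w x| ≤ |M| := fun x => by
    by_cases hx : x ∈ G.board
    · rw [hwv x hx]
      exact (hM x hx).trans (le_abs_self M)
    · simp [w, hx]
  have hwF : ∀ x ∈ G.Γ, w x = F x := fun x hx => (hwv x (Or.inr hx)).trans (hvF x hx)
  have hwDPP : G.SatisfiesDPP w := hDPP.indicator_board hdrift
  refine ⟨fun x₀ hx₀ SA SB => ⟨ae_law_exists_mem_Γ hDf hdrift SA SB hx₀,
    integrable_payoff hDf hdrift hw hwM hwF SA SB hx₀⟩, fun x₀ hx₀ => ?_⟩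
  have hA : (v x₀ : EReal) ≤ G.valueA F x₀ := by
    refine EReal.ge_of_forall_gt_iff_ge.mp fun r hr => ?_
    have hη : 0 < v x₀ - r := sub_pos.mpr (EReal.coe_lt_coe_iff.mp hr)
    obtain ⟨SA, hSA⟩ := exists_strategy_almost_max (G := G) (fun x => (abs_le.mp (hwM x)).2) hη
    refine le_iSup_of_le (ι := G.Strategy) SA (le_iInf fun SB => EReal.coe_le_coe_iff.mpr ?_)
    have := sub_le_integral_payoff hDf hdrift hw hwM hwF SA SB hx₀ hη.le fun k z hz =>
      sub_le_integral_stepLaw_of_max hw hwM hwDPP hz (by positivity) (hSA k z)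
    rw [hwv x₀ hx₀] at this
    linarith
  have hB : G.valueB F x₀ ≤ (v x₀ : EReal) := by
    refine EReal.le_of_forall_lt_iff_le.mp fun r hr => ?_
    have hη : 0 < r - v x₀ := sub_pos.mpr (EReal.coe_lt_coe_iff.mp hr)
    have hwM' : ∀ x, |(-w) x| ≤ |M| := fun x => (abs_neg (w x)).le.trans (hwM x)
    obtain ⟨SB, hSB⟩ := exists_strategy_almost_max (G := G) (fun x => (abs_le.mp (hwM' x)).2) hη
    refine iInf_le_of_le (ι := G.Strategy) SB (iSup_le fun SA => EReal.coe_le_coe_iff.mpr ?_)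
    -- B maximises `-w` with payoff `-F`; exchanging the players puts B in the role of A.
    have := sub_le_integral_payoff (F := -F) hDf hdrift hw.neg hwM'
      (fun x hx => congrArg Neg.neg (hwF x hx)) SA SB hx₀ hη.le fun k z hz => by
        rw [stepLaw_comm SA SB]
        exact sub_le_integral_stepLaw_of_max hw.neg hwM' hwDPP.neg hz (by positivity) (hSB k z)
    have hneg : G.payoff (-F) = fun ω => -G.payoff F ω := rfl
    rw [hneg, integral_neg, Pi.neg_apply, hwv x₀ hx₀] at this
    linarith
  have hAB : G.valueA F x₀ ≤ G.valueB F x₀ := iSup_iInf_le_iInf_iSup _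
  have h1 := le_antisymm (hAB.trans hB) hA
  have h2 := le_antisymm hB (hA.trans hAB)
  exact ⟨h1, h2, h1.trans h2.symm⟩
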